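/- Let $k$ be a field and let $A$ be a finite-dimensional (not necessarily commutative) local $k$-algebra with radical $J$ such that $A/J = k$ and $J^3 = 0$ (a \emph{short} local algebra). Let $e = |J/J^2|$ and $a = |J^2|$, where $|M|$ denotes the length of a module $M$. For a left $A$-module $M$ of finite length, let $\mho M$ be the cokernel of a left minimal left $\operatorname{add}({}_AA)$-approximation $M \to P$. The $\mho$-quiver of $A$ has as vertices the isomorphism classes $[M]$ of the indecomposable non-projective left $A$-modules $M$ of finite length, and there is an arrow $[M] \leftarrow [M']$ if and only if $M$ is torsionless and $M' \simeq \mho M$; an $\mho$-path is a path in this quiver. A non-zero module $M$ with $J^2M = 0$ is called \emph{solid} if every endomorphism of $M$ acts on $\operatorname{soc} M$ as multiplication by a scalar of $k$ (and similarly for right modules). Theorem 2. Assume that $A$ is not self-injective. If there exists an $\mho$-path of length $4$, then $a = e-1 \ge 2$, and the left module ${}_AJ$ and the right module $J_A$ are solid. -/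

import Mathlib

universe u v w

/-- The underlying additive group of `J = rad A`, seen as a submodule of the right module `A_A`
(right `A`-modules are left `Aᵐᵒᵖ`-modules): this is the right module `J_A`. -/
def rightJacobson (A : Type u) [Ring A] : Submodule Aᵐᵒᵖ A where
  carrier := Ring.jacobson A
  add_mem' := fun hx hy => (Ring.jacobson A).add_mem hx hy
  zero_mem' := (Ring.jacobson A).zero_mem
  smul_mem' := fun r _ hx => Ideal.mul_mem_right r.unop (Ring.jacobson A) hx

/-- `e(A) = |J/J²|`, the length of the `A`-module `J/J²`. -/
noncomputable def hilbertE (A : Type u) [Ring A] : ℕ∞ :=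
  Module.length A (↥(Ring.jacobson A) ⧸ (Ring.jacobson A ^ 2).submoduleOf (Ring.jacobson A))

/-- `a(A) = |J²|`, the length of the `A`-module `J²`. -/
noncomputable def hilbertA (A : Type u) [Ring A] : ℕ∞ :=
  Module.length A ↥(Ring.jacobson A ^ 2)

/-- The socle of a module: the sum of its simple submodules. -/
def moduleSocle (A : Type u) [Ring A] (M : Type w) [AddCommGroup M] [Module A M] :
    Submodule A M :=
  sSup {N : Submodule A M | IsSimpleModule A N}

/-- A module `M` is solid if it is non-zero, of Loewy length at most `2`, and every endomorphism
of `M` acts on the socle of `M` as multiplication by a scalar of `k`. -/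
structure IsSolid (k : Type v) (A : Type u) (M : Type w) [Field k] [Ring A] [Algebra k A]
    [AddCommGroup M] [Module A M] : Prop where
  nontrivial : Nontrivial M
  loewy : Ring.jacobson A ^ 2 • (⊤ : Submodule A M) = ⊥
  scalar : ∀ φ : M →ₗ[A] M, ∃ c : k, ∀ x ∈ moduleSocle A M, φ x = algebraMap k A c • x

/-- `M` is indecomposable: non-zero, and not the direct sum of two non-zero submodules. -/
def IsIndecomposableModule (A : Type u) [Ring A] (M : Type w) [AddCommGroup M] [Module A M] :
    Prop :=
  Nontrivial M ∧ ∀ U V : Submodule A M, IsCompl U V → U = ⊥ ∨ V = ⊥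

/-- `P` belongs to `add(A)`: it is (isomorphic to) a direct summand of some `A^n`. -/
def InAdd (A : Type u) [Ring A] (P : Type w) [AddCommGroup P] [Module A P] : Prop :=
  ∃ (n : ℕ) (i : P →ₗ[A] (Fin n → A)) (r : (Fin n → A) →ₗ[A] P), r ∘ₗ i = LinearMap.id

/-- `f : M → P` is a left minimal left `add(A)`-approximation of `M`. (Every module in `add(A)`
is isomorphic to one in the universe of `A`.) -/
structure IsMinLeftAddApprox (A : Type u) [Ring A] {M : Type w} [AddCommGroup M] [Module A M]
    {P : Type u} [AddCommGroup P] [Module A P] (f : M →ₗ[A] P) : Prop where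
  inAdd : InAdd A P
  approx : ∀ (Q : Type u) [AddCommGroup Q] [Module A Q], InAdd A Q →
    ∀ g : M →ₗ[A] Q, ∃ h : P →ₗ[A] Q, h ∘ₗ f = g
  minimal : ∀ h : P →ₗ[A] P, h ∘ₗ f = f → Function.Bijective h

/-- `N ≃ ℧M`: `N` is isomorphic to the cokernel of a left minimal left `add(A)`-approximation
of `M`. -/
def IsMho (A : Type u) [Ring A] (M N : Type w) [AddCommGroup M] [Module A M]
    [AddCommGroup N] [Module A N] : Prop :=
  ∃ (P : Type u) (_ : AddCommGroup P) (_ : Module A P) (f : M →ₗ[A] P),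
    IsMinLeftAddApprox A f ∧ Nonempty (N ≃ₗ[A] (P ⧸ LinearMap.range f))

/-- `M` is torsionless: it embeds into a (not necessarily finitely generated) product of copies
of `A`, i.e. the linear maps `M → A` separate the elements of `M` from `0`. -/
def IsTorsionlessModule (A : Type u) [Ring A] (M : Type w) [AddCommGroup M] [Module A M] :
    Prop :=
  ∀ m : M, m ≠ 0 → ∃ f : M →ₗ[A] A, f m ≠ 0

/-- `M` represents a vertex of the `℧`-quiver of `A`: it is of finite length, indecomposable and
not projective. -/
structure IsMhoVertex (A : Type u) [Ring A] (M : Type w) [AddCommGroup M] [Module A M] :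
    Prop where
  finiteLength : IsFiniteLength A M
  indecomposable : IsIndecomposableModule A M
  notProjective : ¬ Module.Projective A M

/-- There is an `℧`-path of length `n`: a path `[M 0] ← [M 1] ← ⋯ ← [M n]` in the `℧`-quiver,
whose vertices are the isomorphism classes of indecomposable non-projective modules of finite
length, with an arrow `[M] ← [M']` if and only if `M` is torsionless and `M' ≃ ℧M`. -/
def HasMhoPath (A : Type u) [Ring A] (n : ℕ) : Prop :=
  ∃ M : Fin (n + 1) → ModuleCat.{w} A,
    (∀ i, IsMhoVertex A (M i)) ∧
    ∀ i : Fin n, IsTorsionlessModule A (M i.castSucc) ∧ IsMho A (M i.castSucc) (M i.succ)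

/-! The path yields exact sequences `0 → M_i → A^{n_i} → M_{i+1} → 0` for i = 0, 1, 2, with the
image of M_i in J A^{n_i} and every form M_i → A extending to A^{n_i}. Since M_{i+1} is torsionless
and all its forms take values in J, it is killed by J², so M_i contains J² A^{n_i}. These elements
even lie in J M_i: otherwise the left socle of A would be at most a line (`mem_radical_of_single`)
and A would be self-injective (`injective_of_socle_le_span`). Hence J M_i = J² A^{n_i}, and this
carries the rest.

Solidity: both socles of A turn out to be J². An endomorphism of the left module J, composed with a
coordinate of M_0, is a form on M_0; extending it to A^{n_0} shows that on J² it is right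
multiplication by an element of A, that is, by a scalar (`exists_scalar`). For the right module J,
the reflexivity statement `exists_eq_of_relations` for M_1 takes over (`exists_right_scalar`).

Hilbert type: with t_i the dimension of the top of M_i, the equality above gives dim M_i = t_i + n_i
a and dim Hom(M_i, A) = n_i + t_i a, while t_{i+1} = n_i. The sequences and their A-duals are exact,
and comparing the dimension counts forces a + 1 = e (`succ_eq_of_dimension_relations`). -/

/-! ### Arithmetic in a local algebra with J³ = 0. -/

section ShortLocal

variable {k : Type v} [Field k] {A : Type u} [Ring A] [Algebra k A]

theorem Ring.mul_mem_jacobson_sq {x y : A} (hx : x ∈ Ring.jacobson A) (hy : y ∈ Ring.jacobson A) :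
    x * y ∈ Ring.jacobson A ^ 2 := by
  rw [Submodule.pow_succ, Submodule.pow_one]
  exact Ideal.mul_mem_mul hx hy

theorem Ring.mul_mem_jacobson_cube {x y : A} (hx : x ∈ Ring.jacobson A ^ 2)
    (hy : y ∈ Ring.jacobson A) : x * y ∈ Ring.jacobson A ^ 3 := by
  rw [Submodule.pow_succ]
  exact Ideal.mul_mem_mul hx hy

theorem Ring.jacobson_sq_induction {p : A → Prop} {x : A} (hx : x ∈ Ring.jacobson A ^ 2)
    (mul : ∀ y ∈ Ring.jacobson A, ∀ z ∈ Ring.jacobson A, p (y * z))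
    (add : ∀ y z, p y → p z → p (y + z)) : p x := by
  rw [Submodule.pow_succ, Submodule.pow_one] at hx
  exact Submodule.mul_induction_on hx mul add

theorem Ring.jacobson_sq_le : Ring.jacobson A ^ 2 ≤ Ring.jacobson A := fun _ hx =>
  jacobson_sq_induction hx (fun y _ _ hz => (Ring.jacobson A).mul_mem_left y hz)
    (fun _ _ => (Ring.jacobson A).add_mem)

theorem Ring.jacobson_mul_mem_right {x : A} (hx : x ∈ Ring.jacobson A) (y : A) :
    x * y ∈ Ring.jacobson A := Ideal.mul_mem_right y _ hx

theorem exists_residue (hres : Function.Surjective (algebraMap k (A ⧸ Ring.jacobson A))) (x : A) :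
    ∃ c : k, x - algebraMap k A c ∈ Ring.jacobson A := by
  obtain ⟨c, hc⟩ := hres (Ideal.Quotient.mk _ x)
  refine ⟨c, ?_⟩
  rw [← Ideal.Quotient.eq_zero_iff_mem, map_sub, ← hc, sub_eq_zero]
  rfl

theorem jacobson_sq_mul (hshort : Ring.jacobson A ^ 3 = ⊥) {x y : A}
    (hx : x ∈ Ring.jacobson A ^ 2) (hy : y ∈ Ring.jacobson A) : x * y = 0 := by
  simpa [hshort] using Ring.mul_mem_jacobson_cube hx hy

theorem mul_jacobson_sq (hshort : Ring.jacobson A ^ 3 = ⊥) {x y : A}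
    (hx : x ∈ Ring.jacobson A) (hy : y ∈ Ring.jacobson A ^ 2) : x * y = 0 :=
  Ring.jacobson_sq_induction (p := fun y => x * y = 0) hy
    (fun y hy z hz => by
      rw [← mul_assoc]; exact jacobson_sq_mul hshort (Ring.mul_mem_jacobson_sq hx hy) hz)
    (fun y z hy hz => by rw [mul_add, hy, hz, add_zero])

theorem Ring.jacobson_sq_mul_mem_right {x : A} (hx : x ∈ Ring.jacobson A ^ 2) (y : A) :
    x * y ∈ Ring.jacobson A ^ 2 :=
  jacobson_sq_induction (p := fun x => x * y ∈ Ring.jacobson A ^ 2) hx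
    (fun a ha b hb => by
      rw [mul_assoc]; exact mul_mem_jacobson_sq ha (jacobson_mul_mem_right hb y))
    (fun a b ha hb => by rw [add_mul]; exact add_mem ha hb)

theorem isUnit_algebraMap_add (hshort : Ring.jacobson A ^ 3 = ⊥) {c : k} (hc : c ≠ 0) {x : A}
    (hx : x ∈ Ring.jacobson A) : IsUnit (algebraMap k A c + x) := by
  have hx' : c⁻¹ • x ∈ Ring.jacobson A := by
    rw [Algebra.smul_def]; exact (Ring.jacobson A).mul_mem_left _ hx
  have hn : IsNilpotent (c⁻¹ • x) := ⟨3, by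
    rw [pow_succ, pow_two]
    exact jacobson_sq_mul hshort (Ring.mul_mem_jacobson_sq hx' hx') hx'⟩
  have := (hc.isUnit.map (algebraMap k A)).mul hn.isUnit_one_add
  rwa [mul_add, mul_one, ← Algebra.smul_def, smul_inv_smul₀ hc] at this

theorem isUnit_of_notMem_jacobson
    (hres : Function.Surjective (algebraMap k (A ⧸ Ring.jacobson A)))
    (hshort : Ring.jacobson A ^ 3 = ⊥) {x : A} (hx : x ∉ Ring.jacobson A) : IsUnit x := by
  obtain ⟨c, hc⟩ := exists_residue hres x
  have h0 : c ≠ 0 := by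
    rintro rfl
    simp [hx] at hc
  simpa using isUnit_algebraMap_add hshort h0 hc

theorem algebraMap_mem_jacobson_iff [Nontrivial A] {c : k} :
    algebraMap k A c ∈ Ring.jacobson A ↔ c = 0 := by
  refine ⟨fun h => ?_, fun h => by simp [h]⟩
  by_contra hc
  have := (Ring.jacobson A).mul_mem_left (algebraMap k A c⁻¹) h
  rw [← map_mul, inv_mul_cancel₀ hc, map_one] at this
  exact (Ring.jacobson_lt_top (R := A)).ne ((Ideal.eq_top_iff_one _).2 this)

/-- Elements of the square of the radical see only residues, on either side. -/
theorem jacobson_sq_mul_eq_smul (hshort : Ring.jacobson A ^ 3 = ⊥) {x b : A} {c : k}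
    (hx : x ∈ Ring.jacobson A ^ 2) (hb : b - algebraMap k A c ∈ Ring.jacobson A) :
    x * b = c • x := by
  have := jacobson_sq_mul hshort hx hb
  rw [mul_sub, sub_eq_zero] at this
  rw [this, Algebra.smul_def, Algebra.commutes]

theorem mul_jacobson_sq_eq_smul (hshort : Ring.jacobson A ^ 3 = ⊥) {x b : A} {c : k}
    (hx : x ∈ Ring.jacobson A ^ 2) (hb : b - algebraMap k A c ∈ Ring.jacobson A) :
    b * x = c • x := by
  have := mul_jacobson_sq hshort hb hx
  rw [sub_mul, sub_eq_zero] at this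
  rw [this, Algebra.smul_def]

end ShortLocal

/-! ### Forms on indecomposable non-projective modules. -/

section Indecomposable

variable {k : Type v} [Field k] {A : Type u} [Ring A] [Algebra k A]
variable {M : Type w} [AddCommGroup M] [Module A M]

/-- A linear form on an indecomposable non-projective module takes values in the radical. -/
theorem IsIndecomposableModule.apply_mem_jacobson [Nontrivial A]
    (hres : Function.Surjective (algebraMap k (A ⧸ Ring.jacobson A)))
    (hshort : Ring.jacobson A ^ 3 = ⊥) (hM : IsIndecomposableModule A M)
    (hp : ¬ Module.Projective A M) (φ : M →ₗ[A] A) (m : M) : φ m ∈ Ring.jacobson A := by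
  by_contra hm
  obtain ⟨u, hu⟩ := isUnit_of_notMem_jacobson hres hshort hm
  let s : A →ₗ[A] M := LinearMap.toSpanSingleton A M ((↑u⁻¹ : A) • m)
  have hs : ∀ a, φ (s a) = a := fun a => by simp [s, ← hu]
  have hc : IsCompl (LinearMap.range s) (LinearMap.ker φ) := by
    constructor
    · rw [Submodule.disjoint_def]
      rintro _ ⟨a, rfl⟩ ha
      rw [LinearMap.mem_ker, hs] at ha
      simp [ha]
    · rw [codisjoint_iff, eq_top_iff]
      intro x _
      rw [← add_sub_cancel (s (φ x)) x]
      exact Submodule.add_mem_sup ⟨_, rfl⟩ (by simp [hs])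
  rcases hM.2 _ _ hc with h | h
  · have : s 1 ∈ LinearMap.range s := ⟨1, rfl⟩
    rw [h, Submodule.mem_bot] at this
    simpa [this] using hs 1
  · have hb : Function.Bijective φ := ⟨LinearMap.ker_eq_bot.1 h, fun a => ⟨s a, hs a⟩⟩
    exact hp (Module.Projective.of_equiv (LinearEquiv.ofBijective φ hb).symm)

variable [Module k M] [IsScalarTower k A M]

theorem smul_eq_residue_smul {a : A} {c : k} (hc : a - algebraMap k A c ∈ Ring.jacobson A) {x : M}
    (hx : ∀ j ∈ Ring.jacobson A, j • x = 0) : a • x = c • x := by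
  have := hx _ hc
  rwa [sub_smul, sub_eq_zero, algebraMap_smul] at this

theorem exists_linearForm_of_notMem_radical {x : M}
    (hx : x ∉ Ring.jacobson A • (⊤ : Submodule A M)) :
    ∃ l : M →ₗ[k] k, l x ≠ 0 ∧ ∀ j ∈ Ring.jacobson A, ∀ m : M, l (j • m) = 0 := by
  obtain ⟨l, hl, hker⟩ := Submodule.exists_le_ker_of_notMem
    (p := (Ring.jacobson A • (⊤ : Submodule A M)).restrictScalars k) (v := x) hx
  refine ⟨l, hl, fun j hj m => ?_⟩
  have : j • m ∈ (Ring.jacobson A • (⊤ : Submodule A M)).restrictScalars k :=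
    (Submodule.restrictScalars_mem k _ _).2 (Submodule.smul_mem_smul hj Submodule.mem_top)
  exact hker this

end Indecomposable

/-! ### Small socle implies self-injectivity. -/

section Socle

variable {k : Type v} [Field k] {A : Type u} [Ring A] [Algebra k A]

/-- A short local algebra whose left socle is at most one-dimensional is left self-injective. -/
theorem injective_of_socle_le_span [Module.Finite k A]
    (hshort : Ring.jacobson A ^ 3 = ⊥) {z : A}
    (hz : ∀ y : A, (∀ j ∈ Ring.jacobson A, j * y = 0) → ∃ c : k, y = c • z) :
    Module.Injective A A := by
  -- Since J³ = 0, at most two multiplications by radical elements bring a nonzero `a` into the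
  -- socle without killing it.
  have hsoc : ∀ a : A, a ≠ 0 → ∃ s : A, ∃ c : k, s * a = c • z ∧ s * a ≠ 0 := fun a ha => by
    by_cases h1 : ∀ j ∈ Ring.jacobson A, j * a = 0
    · obtain ⟨c, hc⟩ := hz a h1
      exact ⟨1, c, by simpa using hc, by simpa using ha⟩
    push Not at h1
    obtain ⟨j, hj, hja⟩ := h1
    by_cases h2 : ∀ i ∈ Ring.jacobson A, i * (j * a) = 0
    · obtain ⟨c, hc⟩ := hz _ h2
      exact ⟨j, c, hc, hja⟩
    push Not at h2
    obtain ⟨i, hi, hija⟩ := h2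
    rw [← mul_assoc] at hija
    have h3 : ∀ l ∈ Ring.jacobson A, l * (i * j * a) = 0 := fun l hl => by
      rw [← mul_assoc, mul_jacobson_sq hshort hl (Ring.mul_mem_jacobson_sq hi hj), zero_mul]
    obtain ⟨c, hc⟩ := hz _ h3
    exact ⟨i * j, c, hc, hija⟩
  obtain ⟨l, hl⟩ : ∃ l : A →ₗ[k] k, z ≠ 0 → l z ≠ 0 := by
    by_cases h : z = 0
    · exact ⟨0, fun h' => absurd h h'⟩
    · obtain ⟨l, hl, -⟩ := Submodule.exists_le_ker_of_notMem (K := k) (p := (⊥ : Submodule k A))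
        (v := z) (by simpa using h)
      exact ⟨l, fun _ => hl⟩
  have hnd : ∀ a : A, (∀ s, l (s * a) = 0) → a = 0 := fun a ha => by
    by_contra h
    obtain ⟨s, c, hs, hne⟩ := hsoc a h
    have h1 := ha s
    rw [hs] at h1 hne
    have hc : c ≠ 0 := by rintro rfl; simp at hne
    have hz0 : z ≠ 0 := by rintro rfl; simp at hne
    rw [map_smul, smul_eq_mul] at h1
    exact (mul_ne_zero hc (hl hz0)) h1
  -- The form `l (x * a)` is nondegenerate, so it identifies A with its k-dual. In Baer's criterion
  -- it then suffices to extend the functional `l ∘ f` over k and to represent the extension by an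
  -- element `b`.
  let D : A →ₗ[k] (A →ₗ[k] k) :=
    LinearMap.mk₂ k (fun a x => l (x * a)) (by simp [mul_add]) (by simp) (by simp [add_mul])
      (by simp)
  have hDinj : Function.Injective D := by
    rw [injective_iff_map_eq_zero]
    exact fun a ha => hnd a fun s => LinearMap.congr_fun ha s
  have hDsurj : Function.Surjective D :=
    (LinearMap.injective_iff_surjective_of_finrank_eq_finrank
      (Subspace.dual_finrank_eq (K := k) (V := A)).symm).1 hDinj
  refine Module.Baer.injective fun I f => ?_
  obtain ⟨g, hg⟩ := LinearMap.exists_extend (p := I.restrictScalars k)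
    (l ∘ₗ (f.restrictScalars k))
  obtain ⟨b, hb⟩ := hDsurj g
  refine ⟨LinearMap.toSpanSingleton A A b, fun x hx => ?_⟩
  rw [LinearMap.toSpanSingleton_apply, smul_eq_mul, ← sub_eq_zero]
  refine hnd _ fun s => ?_
  have h1 : l (s * x * b) = g (s * x) := LinearMap.congr_fun hb (s * x)
  have h2 : g (s * x) = l (f ⟨s * x, I.mul_mem_left s hx⟩) :=
    LinearMap.congr_fun hg ⟨s * x, I.mul_mem_left s hx⟩
  have h3 : f ⟨s * x, I.mul_mem_left s hx⟩ = s * f ⟨x, hx⟩ := by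
    exact map_smul f s ⟨x, hx⟩
  rw [mul_sub, map_sub, ← mul_assoc, h1, h2, h3, sub_self]

end Socle

/-! ### Free modules and approximation sequences. -/

section Approximation

variable {k : Type v} [Field k] {A : Type u} [Ring A] [Algebra k A]

theorem sum_smul_single {n : ℕ} (p : Fin n → A) :
    ∑ l, p l • (Pi.single l (1 : A) : Fin n → A) = p := by
  ext j
  simp [Finset.sum_apply, Pi.single_apply]

/-- Over a local algebra, the modules in `add(A)` are free. -/
theorem InAdd.exists_linearEquiv [Module.Finite k A] [Nontrivial A]
    (hres : Function.Surjective (algebraMap k (A ⧸ Ring.jacobson A)))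
    {P : Type w} [AddCommGroup P] [Module A P] (hP : InAdd A P) :
    ∃ n : ℕ, Nonempty (P ≃ₗ[A] (Fin n → A)) := by
  let _ : Module k P := Module.compHom P (algebraMap k A)
  have : IsScalarTower k A P := ⟨fun c a x => by
    rw [Algebra.smul_def, mul_smul]; rfl⟩
  obtain ⟨m, i, r, hri⟩ := hP
  have hr : Function.Surjective r := fun x => ⟨i x, LinearMap.congr_fun hri x⟩
  have : Module.Projective A P := Module.Projective.of_split i r hri
  have : Module.Finite A P := Module.Finite.of_surjective r hr
  have : Module.Finite k P := Module.Finite.trans A P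
  have : IsNoetherianRing A := isNoetherian_of_tower k inferInstance
  set R : Submodule A P := Ring.jacobson A • ⊤ with hR
  -- Lifting a basis of P/JP gives a projective cover `p` of P by a free module; it must be
  -- bijective since P is projective.
  let b := Module.finBasis k (P ⧸ R.restrictScalars k)
  choose x hx using fun l => Submodule.mkQ_surjective (R.restrictScalars k) (b l)
  refine ⟨Module.finrank k (P ⧸ R.restrictScalars k), ?_⟩
  let p : (Fin (Module.finrank k (P ⧸ R.restrictScalars k)) → A) →ₗ[A] P :=
    Fintype.linearCombination A x
  have hp : ∀ a, p a = ∑ l, a l • x l := fun a => Fintype.linearCombination_apply A x a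
  have hsurj : Function.Surjective p := by
    rw [← LinearMap.range_eq_top]
    have hfg : (⊤ : Submodule A (P ⧸ LinearMap.range p)).FG := Module.Finite.fg_top
    have hle : (⊤ : Submodule A (P ⧸ LinearMap.range p)) ≤ Ring.jacobson A • ⊤ := by
      intro y _
      obtain ⟨y, rfl⟩ := Submodule.mkQ_surjective _ y
      let c := b.repr (Submodule.mkQ (R.restrictScalars k) y)
      have h1 : y - p (fun l => algebraMap k A (c l)) ∈ R := by
        rw [← Submodule.restrictScalars_mem k, ← Submodule.Quotient.mk_eq_zero,
          ← Submodule.mkQ_apply, map_sub, hp, map_sum, sub_eq_zero]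
        conv_lhs => rw [← b.sum_repr (Submodule.mkQ (R.restrictScalars k) y)]
        refine Finset.sum_congr rfl fun l _ => ?_
        rw [algebraMap_smul, map_smul, hx]
      have h2 : Submodule.mkQ (LinearMap.range p) y =
          Submodule.mkQ (LinearMap.range p) (y - p (fun l => algebraMap k A (c l))) := by
        rw [map_sub, eq_comm, sub_eq_self]
        simp
      rw [h2]
      have h3 := Submodule.mem_map_of_mem (f := Submodule.mkQ (LinearMap.range p)) h1
      have h4 : Submodule.map (Submodule.mkQ (LinearMap.range p)) R ≤ Ring.jacobson A • ⊤ :=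
        (Submodule.map_smul'' _ _ _).trans_le (Submodule.smul_mono le_rfl le_top)
      exact h4 h3
    have htop := hfg.eq_bot_of_le_jacobson_smul hle
    refine eq_top_iff.2 fun y _ => ?_
    rw [← Submodule.Quotient.mk_eq_zero, ← Submodule.mem_bot A, ← htop]
    exact Submodule.mem_top
  have hker : ∀ a, p a = 0 → ∀ l, a l ∈ Ring.jacobson A := by
    intro a ha l
    choose c hc using fun l => exists_residue hres (a l)
    have h1 : ∑ l, c l • b l = 0 := by
      have h2 : p (fun l => a l - algebraMap k A (c l)) ∈ R := by
        rw [hp]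
        exact Submodule.sum_mem _ fun l _ => Submodule.smul_mem_smul (hc l) Submodule.mem_top
      have h3 : p (fun l => a l - algebraMap k A (c l)) = - ∑ l, c l • x l := by
        have : p (fun l => a l - algebraMap k A (c l)) = p a - ∑ l, c l • x l := by
          simp [hp, sub_smul]
        rw [this, ha, zero_sub]
      rw [h3, neg_mem_iff, ← Submodule.restrictScalars_mem k, ← Submodule.Quotient.mk_eq_zero,
        ← Submodule.mkQ_apply, map_sum] at h2
      simpa [hx] using h2
    have := Fintype.linearIndependent_iff.1 b.linearIndependent c h1 l
    simpa [this] using hc l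
  obtain ⟨s, hs⟩ := Module.projective_lifting_property p LinearMap.id hsurj
  have hs' : ∀ y, p (s y) = y := fun y => LinearMap.congr_fun hs y
  refine ⟨(LinearEquiv.ofBijective p ⟨?_, hsurj⟩).symm⟩
  rw [← LinearMap.ker_eq_bot]
  refine Submodule.FG.eq_bot_of_le_jacobson_smul (IsNoetherian.noetherian _) fun a ha => ?_
  -- The projection `id - s ∘ p` onto the kernel fixes `a`. As the `a l` lie in J, the kernel equals
  -- J times itself, and Nakayama applies.
  have h1 : a = ∑ l, a l • (Pi.single l 1 - s (p (Pi.single l 1))) := by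
    have h2 := sum_smul_single a
    simp only [smul_sub, Finset.sum_sub_distrib, ← map_smul, ← map_sum, h2]
    rw [LinearMap.mem_ker.1 ha, map_zero, sub_zero]
  rw [h1]
  exact Submodule.sum_mem _ fun l _ => Submodule.smul_mem_smul (hker a ha l) (by simp [hs'])

/-- An exact sequence `0 → M → Aⁿ → M' → 0` given by an approximation of `M` that lies in the
radical of `Aⁿ`. -/
structure IsApproxSeq {M M' : Type w} [AddCommGroup M] [Module A M] [AddCommGroup M']
    [Module A M'] {n : ℕ} (f : M →ₗ[A] (Fin n → A)) (g : (Fin n → A) →ₗ[A] M') : Prop where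
  injective : Function.Injective f
  surjective : Function.Surjective g
  exact : ∀ p, g p = 0 ↔ ∃ m, f m = p
  extend : ∀ φ : M →ₗ[A] A, ∃ a : Fin n → A, ∀ m, φ m = ∑ l, f m l * a l
  radical : ∀ m l, f m l ∈ Ring.jacobson A

variable {M M' : Type w} [AddCommGroup M] [Module A M] [AddCommGroup M'] [Module A M']

theorem LinearMap.apply_eq_sum_smul {n : ℕ} (g : (Fin n → A) →ₗ[A] M') (p : Fin n → A) :
    g p = ∑ l, p l • g (Pi.single l 1) := by
  conv_lhs => rw [← sum_smul_single p, map_sum]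
  simp only [map_smul]

/-- Every form on M factors through the approximation, so torsionlessness makes it injective; its
coordinates are themselves forms on M, hence J-valued. -/
theorem exists_isApproxSeq [Module.Finite k A] [Nontrivial A]
    (hres : Function.Surjective (algebraMap k (A ⧸ Ring.jacobson A)))
    (hrad : ∀ (φ : M →ₗ[A] A) m, φ m ∈ Ring.jacobson A) (ht : IsTorsionlessModule A M)
    (h : IsMho A M M') :
    ∃ (n : ℕ) (f : M →ₗ[A] (Fin n → A)) (g : (Fin n → A) →ₗ[A] M'), IsApproxSeq f g := by
  obtain ⟨P, _, _, f, hf, ⟨e⟩⟩ := h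
  obtain ⟨n, ⟨ε⟩⟩ := hf.inAdd.exists_linearEquiv hres
  have hA : InAdd A A := ⟨1, LinearMap.pi fun _ => LinearMap.id, LinearMap.proj 0, rfl⟩
  refine ⟨n, ε.toLinearMap ∘ₗ f,
    e.symm.toLinearMap ∘ₗ (LinearMap.range f).mkQ ∘ₗ ε.symm.toLinearMap, ?_, ?_, ?_, ?_, ?_⟩
  · rw [injective_iff_map_eq_zero]
    intro m hm
    by_contra hne
    obtain ⟨φ, hφ⟩ := ht m hne
    obtain ⟨ψ, rfl⟩ := hf.approx A hA φ
    have : f m = 0 := by simpa using hm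
    simp [this] at hφ
  · exact e.symm.surjective.comp ((Submodule.mkQ_surjective _).comp ε.symm.surjective)
  · intro p
    simp only [LinearMap.comp_apply, LinearEquiv.coe_coe, LinearEquiv.map_eq_zero_iff,
      Submodule.mkQ_apply, Submodule.Quotient.mk_eq_zero, LinearMap.mem_range,
      LinearEquiv.eq_symm_apply]
  · intro φ
    obtain ⟨ψ, rfl⟩ := hf.approx A hA φ
    refine ⟨fun l => ψ (ε.symm (Pi.single l 1)), fun m => ?_⟩
    have := LinearMap.apply_eq_sum_smul (ψ ∘ₗ ε.symm.toLinearMap) (ε (f m))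
    simpa using this
  · exact fun m l => hrad (LinearMap.proj l ∘ₗ ε.toLinearMap ∘ₗ f) m

end Approximation

/-! ### Consequences of a torsionless cokernel: J M = J² Aⁿ, the left socle, left scalars. -/

section ApproximationSequence

variable {k : Type v} [Field k] {A : Type u} [Ring A] [Algebra k A]
variable {M M' : Type w} [AddCommGroup M] [Module A M] [AddCommGroup M'] [Module A M']

theorem IsTorsionlessModule.smul_eq_zero (ht : IsTorsionlessModule A M)
    (hrad : ∀ (φ : M →ₗ[A] A) m, φ m ∈ Ring.jacobson A) {r : A}
    (hr : ∀ j ∈ Ring.jacobson A, r * j = 0) (m : M) : r • m = 0 := by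
  by_contra h
  obtain ⟨φ, hφ⟩ := ht _ h
  rw [map_smul] at hφ
  exact hφ (hr _ (hrad φ m))

theorem eq_zero_of_mem_radical {B : Type*} [AddCommGroup B] (l : M →+ B)
    (hl : ∀ j ∈ Ring.jacobson A, ∀ m : M, l (j • m) = 0) {m : M}
    (hm : m ∈ Ring.jacobson A • (⊤ : Submodule A M)) : l m = 0 :=
  Submodule.smul_induction_on (p := fun m => l m = 0) hm (fun j hj m _ => hl j hj m)
    (fun x y hx hy => by rw [map_add, hx, hy, add_zero])

namespace IsApproxSeq

variable {n : ℕ} {f : M →ₗ[A] (Fin n → A)} {g : (Fin n → A) →ₗ[A] M'}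

theorem pos [Nontrivial M] (S : IsApproxSeq f g) : 0 < n := by
  rcases Nat.eq_zero_or_pos n with rfl | h
  · obtain ⟨x, y, hxy⟩ := exists_pair_ne M
    exact absurd (S.injective (Subsingleton.elim _ _)) hxy
  · exact h

theorem exists_eq_single (S : IsApproxSeq f g) {r : A} (hr : ∀ m : M', r • m = 0) (l : Fin n) :
    ∃ m, f m = Pi.single l r := by
  rw [← S.exact]
  have : (Pi.single l r : Fin n → A) = r • Pi.single l 1 := by
    rw [← Pi.single_smul, smul_eq_mul, mul_one]
  rw [this, map_smul, hr]

theorem apply_mem_sq (S : IsApproxSeq f g) {m : M}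
    (hm : m ∈ Ring.jacobson A • (⊤ : Submodule A M)) (l : Fin n) :
    f m l ∈ Ring.jacobson A ^ 2 :=
  Submodule.smul_induction_on (p := fun m => f m l ∈ Ring.jacobson A ^ 2) hm
    (fun j hj m _ => by
      rw [map_smul]
      exact Ring.mul_mem_jacobson_sq hj (S.radical m l))
    (fun x y hx hy => by rw [map_add]; exact add_mem hx hy)

theorem map_mul_eq {φ : M →ₗ[A] A} {a : Fin n → A} (h : ∀ m, φ m = ∑ l, f m l * a l) {m : M}
    {l : Fin n} {r : A} (hm : f m = Pi.single l r) : φ m = r * a l := by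
  rw [h, hm, Finset.sum_eq_single l] <;> simp +contextual

/-- If `f` maps the radical of `M` onto the square radical of `Aⁿ`, a combination of the
coordinates of `f` that kills the radical has coefficients in the radical. -/
theorem coeff_mem_jacobson
    (hres : Function.Surjective (algebraMap k (A ⧸ Ring.jacobson A)))
    (hshort : Ring.jacobson A ^ 3 = ⊥) (hsq : ∃ r ∈ Ring.jacobson A ^ 2, r ≠ 0)
    (hf : ∀ r ∈ Ring.jacobson A ^ 2, ∀ l : Fin n,
      ∃ m ∈ Ring.jacobson A • (⊤ : Submodule A M), f m = Pi.single l r)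
    {φ : M →ₗ[A] A} (hφ : ∀ m ∈ Ring.jacobson A • (⊤ : Submodule A M), φ m = 0)
    {a : Fin n → A} (ha : ∀ m, φ m = ∑ l, f m l * a l) (l : Fin n) :
    a l ∈ Ring.jacobson A := by
  by_contra h
  obtain ⟨r, hr, hr0⟩ := hsq
  obtain ⟨m, hm, hfm⟩ := hf r hr l
  have h1 := map_mul_eq ha hfm
  rw [hφ m hm, eq_comm, (isUnit_of_notMem_jacobson hres hshort h).mul_left_eq_zero] at h1
  exact hr0 h1

theorem exists_scalar [Nontrivial M]
    (hres : Function.Surjective (algebraMap k (A ⧸ Ring.jacobson A)))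
    (hshort : Ring.jacobson A ^ 3 = ⊥) (S : IsApproxSeq f g)
    (hf : ∀ r ∈ Ring.jacobson A ^ 2, ∀ l : Fin n, ∃ m, f m = Pi.single l r)
    (φ : ↥(Ring.jacobson A) →ₗ[A] ↥(Ring.jacobson A)) :
    ∃ c : k, ∀ x : ↥(Ring.jacobson A), (x : A) ∈ Ring.jacobson A ^ 2 →
      (φ x : A) = c • (x : A) := by
  let l : Fin n := ⟨0, S.pos⟩
  -- Extending this form to Aⁿ and evaluating it at the vector with single entry x gives `φ x = x *
  -- a l`; only the residue of `a l` matters on J².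
  let ψ : M →ₗ[A] A := (Ring.jacobson A).subtype ∘ₗ φ ∘ₗ
    (LinearMap.proj l ∘ₗ f).codRestrict (Ring.jacobson A) fun m => S.radical m l
  obtain ⟨a, ha⟩ := S.extend ψ
  obtain ⟨c, hc⟩ := exists_residue hres (a l)
  refine ⟨c, fun x hx => ?_⟩
  obtain ⟨m, hm⟩ := hf x hx l
  have h1 := map_mul_eq ha hm
  rw [jacobson_sq_mul_eq_smul hshort hx hc] at h1
  rw [← h1]
  have : (LinearMap.proj l ∘ₗ f).codRestrict (Ring.jacobson A) (fun m => S.radical m l) m = x :=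
    Subtype.ext (by change f m l = x; rw [hm, Pi.single_eq_same])
  simp only [ψ, LinearMap.comp_apply, this, Submodule.subtype_apply]

end IsApproxSeq

/-- A `k`-linear map that factors over the top of `M` and lands in the socle is `A`-linear. -/
theorem exists_linearMap_of_annihilated [Module k M] [IsScalarTower k A M]
    (hres : Function.Surjective (algebraMap k (A ⧸ Ring.jacobson A))) (χ : M →ₗ[k] A)
    (h1 : ∀ j ∈ Ring.jacobson A, ∀ m : M, χ (j • m) = 0)
    (h2 : ∀ j ∈ Ring.jacobson A, ∀ m : M, j * χ m = 0) :
    ∃ φ : M →ₗ[A] A, ∀ m, φ m = χ m :=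
  ⟨{ toFun := χ
     map_add' := map_add χ
     map_smul' := fun a m => by
       obtain ⟨c, hc⟩ := exists_residue hres a
       have h3 := h1 _ hc m
       have h4 := h2 _ hc m
       rw [sub_smul, map_sub, sub_eq_zero, algebraMap_smul, χ.map_smul] at h3
       rw [sub_mul, sub_eq_zero, ← Algebra.smul_def] at h4
       rw [h3, RingHom.id_apply, smul_eq_mul, h4] }, fun _ => rfl⟩

theorem exists_linearMap_smul [Module k M] [IsScalarTower k A M]
    (hres : Function.Surjective (algebraMap k (A ⧸ Ring.jacobson A))) (l : M →ₗ[k] k)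
    (hl : ∀ j ∈ Ring.jacobson A, ∀ m : M, l (j • m) = 0) {y : A}
    (hy : ∀ j ∈ Ring.jacobson A, j * y = 0) :
    ∃ φ : M →ₗ[A] A, ∀ m, φ m = l m • y :=
  exists_linearMap_of_annihilated hres (l.smulRight y)
    (fun j hj m => by simp [hl j hj m]) (fun j hj m => by simp [hy j hj])

namespace IsApproxSeq

variable {n : ℕ} {f : M →ₗ[A] (Fin n → A)} {g : (Fin n → A) →ₗ[A] M'}
variable [Module k M] [IsScalarTower k A M]

/-- If `m` were nonzero in the top of M, some form would send it to a nonzero multiple of any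
prescribed left socle element `y`. Its extension to Aⁿ sends `m` to `z * a l`, a scalar multiple of
`z`, so the whole left socle would lie in k z. -/
theorem mem_radical_of_single [Module.Finite k A]
    (hres : Function.Surjective (algebraMap k (A ⧸ Ring.jacobson A)))
    (hshort : Ring.jacobson A ^ 3 = ⊥) (hinj : ¬ Module.Injective A A)
    (S : IsApproxSeq f g) {z : A} (hz : ∀ j ∈ Ring.jacobson A, z * j = 0)
    {m : M} {l : Fin n} (hm : f m = Pi.single l z) :
    m ∈ Ring.jacobson A • (⊤ : Submodule A M) := by
  by_contra hmJ
  refine hinj (injective_of_socle_le_span (k := k) hshort (z := z) fun y hy => ?_)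
  obtain ⟨t, ht, htJ⟩ := exists_linearForm_of_notMem_radical (k := k) hmJ
  obtain ⟨φ, hφ⟩ := exists_linearMap_smul hres t htJ hy
  obtain ⟨a, ha⟩ := S.extend φ
  obtain ⟨c, hc⟩ := exists_residue hres (a l)
  have h1 := map_mul_eq ha hm
  have h2 := hz _ hc
  rw [mul_sub, sub_eq_zero, ← Algebra.commutes, ← Algebra.smul_def] at h2
  rw [hφ, h2] at h1
  exact ⟨(t m)⁻¹ * c, by rw [mul_smul, ← h1, inv_smul_smul₀ ht]⟩

/-- If J² = 0, a nonzero coordinate z of an element of M would satisfy zJ = 0 and so kill M'. The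
vector with single entry z would then come from J M, forcing z ∈ J² = 0. -/
theorem exists_mem_sq_ne_zero [Module.Finite k A] [Nontrivial M]
    (hres : Function.Surjective (algebraMap k (A ⧸ Ring.jacobson A)))
    (hshort : Ring.jacobson A ^ 3 = ⊥) (hinj : ¬ Module.Injective A A)
    (S : IsApproxSeq f g) (ht : IsTorsionlessModule A M')
    (hrad : ∀ (φ : M' →ₗ[A] A) m, φ m ∈ Ring.jacobson A) :
    ∃ r ∈ Ring.jacobson A ^ 2, r ≠ 0 := by
  by_contra! h
  have hJ : ∀ x ∈ Ring.jacobson A, ∀ y ∈ Ring.jacobson A, x * y = 0 := fun x hx y hy =>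
    h _ (Ring.mul_mem_jacobson_sq hx hy)
  obtain ⟨m, hm⟩ := exists_ne (0 : M)
  obtain ⟨l, hl⟩ : ∃ l, f m l ≠ 0 := by
    by_contra! hl
    exact hm (S.injective (by rw [map_zero]; exact funext hl))
  have hz := S.radical m l
  obtain ⟨m', hm'⟩ := S.exists_eq_single (ht.smul_eq_zero hrad (hJ _ hz)) l
  have h1 := S.mem_radical_of_single hres hshort hinj (hJ _ hz) hm'
  have h2 := h _ (S.apply_mem_sq h1 l)
  rw [hm', Pi.single_eq_same] at h2
  exact hl h2

/-- This is the inclusion J² Aⁿ ⊆ f(J M); the reverse one is `apply_mem_sq`. -/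
theorem exists_mem_radical_eq_single [Module.Finite k A]
    (hres : Function.Surjective (algebraMap k (A ⧸ Ring.jacobson A)))
    (hshort : Ring.jacobson A ^ 3 = ⊥) (hinj : ¬ Module.Injective A A)
    (S : IsApproxSeq f g) (ht : IsTorsionlessModule A M')
    (hrad : ∀ (φ : M' →ₗ[A] A) m, φ m ∈ Ring.jacobson A) {r : A}
    (hr : r ∈ Ring.jacobson A ^ 2) (l : Fin n) :
    ∃ m ∈ Ring.jacobson A • (⊤ : Submodule A M), f m = Pi.single l r := by
  obtain ⟨m, hm⟩ := S.exists_eq_single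
    (ht.smul_eq_zero hrad fun j hj => jacobson_sq_mul hshort hr hj) l
  exact ⟨m, S.mem_radical_of_single hres hshort hinj
    (fun j hj => jacobson_sq_mul hshort hr hj) hm, hm⟩

/-- The left socle of `A` is contained in the square of the radical. -/
theorem mem_sq_of_annihilated [Module.Finite A M] [Nontrivial M]
    (hres : Function.Surjective (algebraMap k (A ⧸ Ring.jacobson A)))
    (hshort : Ring.jacobson A ^ 3 = ⊥) (hsq : ∃ r ∈ Ring.jacobson A ^ 2, r ≠ 0)
    (S : IsApproxSeq f g)
    (hf : ∀ r ∈ Ring.jacobson A ^ 2, ∀ l : Fin n,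
      ∃ m ∈ Ring.jacobson A • (⊤ : Submodule A M), f m = Pi.single l r)
    {x : A} (hx : ∀ j ∈ Ring.jacobson A, j * x = 0) : x ∈ Ring.jacobson A ^ 2 := by
  obtain ⟨m₀, hm₀⟩ : ∃ m : M, m ∉ Ring.jacobson A • (⊤ : Submodule A M) := by
    by_contra! h
    exact bot_ne_top (Submodule.FG.eq_bot_of_le_jacobson_smul
      (N := (⊤ : Submodule A M)) Module.Finite.fg_top fun m _ => h m).symm
  obtain ⟨t, ht, htJ⟩ := exists_linearForm_of_notMem_radical (k := k) hm₀
  obtain ⟨φ, hφ⟩ := exists_linearMap_smul hres t htJ hx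
  obtain ⟨a, ha⟩ := S.extend φ
  -- The form `t · x` kills J M, so it extends with coefficients in J; since f also has values in J,
  -- the form takes values in J².
  have haJ := coeff_mem_jacobson hres hshort hsq hf (φ := φ) (fun m hm => by
    rw [hφ, show t m = 0 from eq_zero_of_mem_radical t.toAddMonoidHom htJ hm, zero_smul]) ha
  have h1 : φ m₀ ∈ Ring.jacobson A ^ 2 := by
    rw [ha]
    exact Submodule.sum_mem _ fun l _ => Ring.mul_mem_jacobson_sq (S.radical _ _) (haJ l)
  rw [hφ] at h1
  have h2 := (Ring.jacobson A ^ 2).mul_mem_left (algebraMap k A (t m₀)⁻¹) h1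
  rwa [← Algebra.smul_def, inv_smul_smul₀ ht] at h2

end IsApproxSeq

end ApproximationSequence

/-! ### Reflexivity, the right socle and right scalars. -/

section RightModule

variable {k : Type v} [Field k] {A : Type u} [Ring A] [Algebra k A]
variable {M₀ M₁ M₂ : Type w} [AddCommGroup M₀] [Module A M₀] [AddCommGroup M₁] [Module A M₁]
  [AddCommGroup M₂] [Module A M₂]

namespace IsApproxSeq

variable {n₀ n₁ : ℕ} {f₀ : M₀ →ₗ[A] (Fin n₀ → A)} {g₀ : (Fin n₀ → A) →ₗ[A] M₁}
  {f₁ : M₁ →ₗ[A] (Fin n₁ → A)} {g₁ : (Fin n₁ → A) →ₗ[A] M₂}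

/-- Reflexivity: if the cokernel of the approximation of `M₁` is torsionless, then a vector
satisfying all right linear relations between the coordinate functions of `M₁` lies in `M₁`. -/
theorem exists_eq_of_relations (S : IsApproxSeq f₁ g₁) (ht : IsTorsionlessModule A M₂)
    {p : Fin n₁ → A}
    (hp : ∀ d : Fin n₁ → A, (∀ m, ∑ l, f₁ m l * d l = 0) → ∑ l, p l * d l = 0) :
    ∃ m, f₁ m = p := by
  rw [← S.exact]
  by_contra h
  obtain ⟨χ, hχ⟩ := ht _ h
  have h1 : ∀ q : Fin n₁ → A, χ (g₁ q) = ∑ l, q l * χ (g₁ (Pi.single l 1)) := fun q =>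
    LinearMap.apply_eq_sum_smul (χ ∘ₗ g₁) q
  -- The values of `χ ∘ g₁` on the standard basis form a relation on M₁, so `χ ∘ g₁` vanishes at p,
  -- against the choice of χ.
  refine hχ ((h1 p).trans (hp _ fun m => ?_))
  rw [← h1, (S.exact _).2 ⟨m, rfl⟩, map_zero]

/-- A form on `Aⁿ` that kills the kernel of `g₀` descends to the cokernel. -/
theorem exists_form (S : IsApproxSeq f₀ g₀) {ψ : (Fin n₀ → A) →ₗ[A] A}
    (hle : LinearMap.ker g₀ ≤ LinearMap.ker ψ) : ∃ h : M₁ →ₗ[A] A, ∀ p, h (g₀ p) = ψ p := by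
  refine ⟨(LinearMap.ker g₀).liftQ _ hle ∘ₗ
    (g₀.quotKerEquivOfSurjective S.surjective).symm.toLinearMap, fun p => ?_⟩
  have : (g₀.quotKerEquivOfSurjective S.surjective).symm (g₀ p) = Submodule.Quotient.mk p := by
    rw [LinearEquiv.symm_apply_eq]
    rfl
  simp [this]

/-- Right multiplication of a coordinate by a socle element descends to the cokernel. -/
theorem exists_form_of_mem_sq (hshort : Ring.jacobson A ^ 3 = ⊥) (S : IsApproxSeq f₀ g₀)
    (l : Fin n₀) {r : A} (hr : r ∈ Ring.jacobson A ^ 2) :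
    ∃ h : M₁ →ₗ[A] A, ∀ p, h (g₀ p) = p l * r := by
  obtain ⟨h, hh⟩ := S.exists_form
    (ψ := LinearMap.toSpanSingleton A A r ∘ₗ LinearMap.proj l) fun p hp => by
      obtain ⟨m, rfl⟩ := (S.exact p).1 hp
      simpa using mul_jacobson_sq hshort (S.radical m l) hr
  exact ⟨h, fun p => by simp [hh]⟩

/-- The right socle of `A` is contained in the square of the radical. -/
theorem mem_sq_of_right_annihilated [Nontrivial M₁]
    (hres : Function.Surjective (algebraMap k (A ⧸ Ring.jacobson A)))
    (hshort : Ring.jacobson A ^ 3 = ⊥) (hsq : ∃ r ∈ Ring.jacobson A ^ 2, r ≠ 0)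
    (S₀ : IsApproxSeq f₀ g₀) (S₁ : IsApproxSeq f₁ g₁) (ht : IsTorsionlessModule A M₂)
    (hf : ∀ r ∈ Ring.jacobson A ^ 2, ∀ l : Fin n₁,
      ∃ m ∈ Ring.jacobson A • (⊤ : Submodule A M₁), f₁ m = Pi.single l r)
    {x : A} (hx : ∀ j ∈ Ring.jacobson A, x * j = 0) : x ∈ Ring.jacobson A ^ 2 := by
  by_contra hxsq
  let l : Fin n₁ := ⟨0, S₁.pos⟩
  -- Every relation between the coordinates of M₁ has coefficients in J, and x kills J from the
  -- left.
  obtain ⟨m, hm⟩ := S₁.exists_eq_of_relations ht (p := Pi.single l x) fun d hd => by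
    rw [Finset.sum_eq_single l]
    · rw [Pi.single_eq_same]
      exact hx _ (coeff_mem_jacobson hres hshort hsq hf (φ := 0) (fun _ _ => rfl)
        (fun m => (hd m).symm) l)
    · intro i _ hi
      rw [Pi.single_eq_of_ne hi, zero_mul]
    · simp
  obtain ⟨b, rfl⟩ := S₀.surjective m
  obtain ⟨i, hi⟩ : ∃ i, b i ∉ Ring.jacobson A := by
    by_contra! h
    have h1 : g₀ b ∈ Ring.jacobson A • (⊤ : Submodule A M₁) := by
      rw [LinearMap.apply_eq_sum_smul]
      exact Submodule.sum_mem _ fun i _ => Submodule.smul_mem_smul (h i) Submodule.mem_top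
    have h2 := S₁.apply_mem_sq h1 l
    rw [hm, Pi.single_eq_same] at h2
    exact hxsq h2
  obtain ⟨r, hr, hr0⟩ := hsq
  -- This form is computed at `g₀ b` in two ways: as `b i * r`, nonzero because `b i` is a unit, and
  -- as `x * d l`, a scalar multiple of x. So x lies in J².
  obtain ⟨h, hh⟩ := S₀.exists_form_of_mem_sq hshort i hr
  obtain ⟨d, hd⟩ := S₁.extend h
  obtain ⟨c, hc⟩ := exists_residue hres (d l)
  have h1 := map_mul_eq hd hm
  have h2 := hx _ hc
  rw [mul_sub, sub_eq_zero, ← Algebra.commutes, ← Algebra.smul_def] at h2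
  rw [hh, h2] at h1
  have hc0 : c ≠ 0 := by
    rintro rfl
    rw [zero_smul, (isUnit_of_notMem_jacobson hres hshort hi).mul_right_eq_zero] at h1
    exact hr0 h1
  apply hxsq
  have h3 := (Ring.jacobson A ^ 2).mul_mem_left (algebraMap k A c⁻¹ * b i) hr
  rwa [mul_assoc, h1, ← Algebra.smul_def, inv_smul_smul₀ hc0] at h3

theorem exists_right_scalar [Nontrivial M₀]
    (hres : Function.Surjective (algebraMap k (A ⧸ Ring.jacobson A)))
    (hshort : Ring.jacobson A ^ 3 = ⊥)
    (S₀ : IsApproxSeq f₀ g₀) (S₁ : IsApproxSeq f₁ g₁) (ht : IsTorsionlessModule A M₂)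
    (φ : ↥(rightJacobson A) →ₗ[Aᵐᵒᵖ] ↥(rightJacobson A)) :
    ∃ c : k, ∀ x : ↥(rightJacobson A), (x : A) ∈ Ring.jacobson A ^ 2 →
      (φ x : A) = c • (x : A) := by
  let i : Fin n₀ := ⟨0, S₀.pos⟩
  let y : Fin n₁ → ↥(rightJacobson A) := fun l =>
    ⟨f₁ (g₀ (Pi.single i 1)) l, S₁.radical _ l⟩
  have hφ : ∀ d : Fin n₁ → A, ∑ l, (φ (y l) : A) * d l =
      (φ (∑ l, MulOpposite.op (d l) • y l) : A) := fun d => by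
    simp [map_sum]
  have hy : ∀ d : Fin n₁ → A, ((∑ l, MulOpposite.op (d l) • y l : ↥(rightJacobson A)) : A) =
      ∑ l, f₁ (g₀ (Pi.single i 1)) l * d l := fun d => by
    simp [y]
  -- Right linearity of φ preserves the right relations satisfied by the row `y`, so applying φ
  -- entrywise gives another element of M₁.
  obtain ⟨m, hm⟩ := S₁.exists_eq_of_relations ht (p := fun l => (φ (y l) : A)) fun d hd => by
    have : (∑ l, MulOpposite.op (d l) • y l : ↥(rightJacobson A)) = 0 :=
      Subtype.ext (by rw [hy, hd]; rfl)
    rw [hφ, this, map_zero]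
    rfl
  obtain ⟨b, rfl⟩ := S₀.surjective m
  obtain ⟨c, hc⟩ := exists_residue hres (b i)
  refine ⟨c, fun x hx => ?_⟩
  -- This form sends the i-th generator of M₁ to x. Its extension `d` writes x as `∑ y l * d l`, and
  -- evaluation at `g₀ b` gives `φ x = b i * x`.
  obtain ⟨h, hh⟩ := S₀.exists_form_of_mem_sq hshort i hx
  obtain ⟨d, hd⟩ := S₁.extend h
  have h1 : (∑ l, MulOpposite.op (d l) • y l : ↥(rightJacobson A)) = x :=
    Subtype.ext (by rw [hy, ← hd, hh]; simp)
  have h2 := hφ d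
  rw [h1] at h2
  have h3 := hd (g₀ b)
  rw [hm, hh, h2, mul_jacobson_sq_eq_smul hshort hx hc] at h3
  exact h3.symm

end IsApproxSeq

end RightModule

/-! ### From scalars on J² to solidity. -/

section Solid

variable {k : Type v} [Field k] {A : Type u} [Ring A] [Algebra k A]

theorem moduleSocle_le {R : Type u} [Ring R] {X : Type w} [AddCommGroup X] [Module R X]
    {p : Submodule R X} (h : ∀ N : Submodule R X, IsSimpleModule R N → N ≤ p) :
    moduleSocle R X ≤ p := sSup_le h

theorem isSolid_jacobson (hshort : Ring.jacobson A ^ 3 = ⊥)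
    (hsq : ∃ r ∈ Ring.jacobson A ^ 2, r ≠ 0)
    (hsoc : ∀ x : A, (∀ j ∈ Ring.jacobson A, j * x = 0) → x ∈ Ring.jacobson A ^ 2)
    (hscalar : ∀ φ : ↥(Ring.jacobson A) →ₗ[A] ↥(Ring.jacobson A), ∃ c : k,
      ∀ x : ↥(Ring.jacobson A), (x : A) ∈ Ring.jacobson A ^ 2 → (φ x : A) = c • (x : A)) :
    IsSolid k A ↥(Ring.jacobson A) := by
  refine ⟨?_, ?_, fun φ => ?_⟩
  · obtain ⟨r, hr, hr0⟩ := hsq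
    exact ⟨⟨r, Ring.jacobson_sq_le hr⟩, 0, fun h => hr0 (congrArg Subtype.val h)⟩
  · rw [eq_bot_iff]
    exact Submodule.smul_le.2 fun r hr x _ =>
      (Submodule.mem_bot A).2 (Subtype.ext (jacobson_sq_mul hshort hr x.2))
  · obtain ⟨c, hc⟩ := hscalar φ
    refine ⟨c, fun x hx => Subtype.ext ?_⟩
    have hle : moduleSocle A ↥(Ring.jacobson A) ≤
        (Ring.jacobson A ^ 2).submoduleOf (Ring.jacobson A) := by
      refine moduleSocle_le fun N hN y hy => hsoc _ fun j hj => ?_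
      have h1 : j • (⟨y, hy⟩ : N) ∈ (Ring.jacobson A) • (⊤ : Submodule A N) :=
        Submodule.smul_mem_smul hj Submodule.mem_top
      have h2 := Ring.jacobson_smul_top_le A N h1
      rw [IsSimpleModule.jacobson_eq_bot, Submodule.mem_bot] at h2
      exact congrArg (fun z : N => ((z : ↥(Ring.jacobson A)) : A)) h2
    rw [hc x (hle hx), Algebra.smul_def]
    rfl

theorem isSolid_rightJacobson [Nontrivial A]
    (hres : Function.Surjective (algebraMap k (A ⧸ Ring.jacobson A)))
    (hshort : Ring.jacobson A ^ 3 = ⊥)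
    (hsq : ∃ r ∈ Ring.jacobson A ^ 2, r ≠ 0)
    (hsoc : ∀ x : A, (∀ j ∈ Ring.jacobson A, x * j = 0) → x ∈ Ring.jacobson A ^ 2)
    (hscalar : ∀ φ : ↥(rightJacobson A) →ₗ[Aᵐᵒᵖ] ↥(rightJacobson A), ∃ c : k,
      ∀ x : ↥(rightJacobson A), (x : A) ∈ Ring.jacobson A ^ 2 → (φ x : A) = c • (x : A)) :
    IsSolid k Aᵐᵒᵖ ↥(rightJacobson A) := by
  have hop : ∀ j : Aᵐᵒᵖ, j ∈ Ring.jacobson Aᵐᵒᵖ → j.unop ∈ Ring.jacobson A := fun j hj => by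
    by_contra h
    have hu : IsUnit j := (isUnit_of_notMem_jacobson hres hshort h).op
    exact (Ring.jacobson_lt_top (R := Aᵐᵒᵖ)).ne (Ideal.eq_top_of_isUnit_mem _ hj hu)
  -- Substituting `x = x * j` into itself gives `x = x * j³ = 0`. This replaces Nakayama for simple
  -- right submodules below.
  have hnil : ∀ x : A, ∀ j ∈ Ring.jacobson A, x = x * j → x = 0 := fun x j hj h => by
    have hj2 := Ring.mul_mem_jacobson_sq hj hj
    rw [h, h, h, mul_assoc, mul_assoc, ← mul_assoc j, jacobson_sq_mul hshort hj2 hj, mul_zero]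
  refine ⟨?_, ?_, fun φ => ?_⟩
  · obtain ⟨r, hr, hr0⟩ := hsq
    exact ⟨⟨r, Ring.jacobson_sq_le hr⟩, 0, fun h => hr0 (congrArg Subtype.val h)⟩
  · rw [eq_bot_iff]
    refine Submodule.smul_le.2 fun r hr x _ => (Submodule.mem_bot _).2 (Subtype.ext ?_)
    change (x : A) * r.unop = 0
    refine Ring.jacobson_sq_induction (p := fun r : Aᵐᵒᵖ => (x : A) * r.unop = 0) hr
      (fun y hy z hz => ?_) fun y z hy hz => ?_
    · rw [MulOpposite.unop_mul, ← mul_assoc]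
      exact jacobson_sq_mul hshort (Ring.mul_mem_jacobson_sq x.2 (hop z hz)) (hop y hy)
    · rw [MulOpposite.unop_add, mul_add, hy, hz, add_zero]
  · obtain ⟨c, hc⟩ := hscalar φ
    refine ⟨c, fun x hx => Subtype.ext ?_⟩
    let T : Submodule Aᵐᵒᵖ ↥(rightJacobson A) :=
      { carrier := {x | (x : A) ∈ Ring.jacobson A ^ 2}
        add_mem' := fun ha hb => (Ring.jacobson A ^ 2).add_mem ha hb
        zero_mem' := (Ring.jacobson A ^ 2).zero_mem
        smul_mem' := fun r _ hx => Ring.jacobson_sq_mul_mem_right hx r.unop }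
    have hle : moduleSocle Aᵐᵒᵖ ↥(rightJacobson A) ≤ T := by
      refine moduleSocle_le fun N hN y hy => hsoc _ fun j hj => ?_
      by_contra hne
      let z : N := MulOpposite.op j • ⟨y, hy⟩
      have hz : z ≠ 0 := fun h =>
        hne (congrArg (fun z : N => ((z : ↥(rightJacobson A)) : A)) h)
      have hsm : IsSimpleModule Aᵐᵒᵖ N := hN
      obtain ⟨r, hr⟩ := IsSimpleModule.toSpanSingleton_surjective Aᵐᵒᵖ (M := N) hz ⟨y, hy⟩
      have h1 : (y : A) * j * r.unop = y :=
        congrArg (fun z : N => ((z : ↥(rightJacobson A)) : A)) hr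
      refine hne ?_
      rw [hnil y (j * r.unop) (Ring.jacobson_mul_mem_right hj _) (by rw [← mul_assoc, h1]),
        zero_mul]
    rw [hc x (hle hx), Algebra.smul_def, Algebra.commutes]
    rfl

end Solid

/-! ### Dimensions of the modules in a sequence and of their duals. -/

section Dimension

variable {k : Type v} [Field k] {A : Type u} [Ring A] [Algebra k A]

/-- Length over `A` is dimension over `k` for modules killed by the radical. -/
theorem length_eq_finrank_of_annihilated
    (hres : Function.Surjective (algebraMap k (A ⧸ Ring.jacobson A)))
    {X : Type w} [AddCommGroup X] [Module A X] [Module k X] [IsScalarTower k A X]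
    [Module.Finite k X] (hX : ∀ j ∈ Ring.jacobson A, ∀ x : X, j • x = 0) :
    Module.length A X = Module.finrank k X := by
  let e : Submodule A X ≃o Submodule k X :=
    { toFun := fun N => N.restrictScalars k
      invFun := fun N =>
        { toAddSubmonoid := N.toAddSubmonoid
          smul_mem' := fun a x hx => by
            obtain ⟨c, hc⟩ := exists_residue hres a
            rw [smul_eq_residue_smul hc fun j hj => hX j hj x]
            exact N.smul_mem c hx }
      left_inv := fun _ => rfl
      right_inv := fun _ => rfl
      map_rel_iff' := Iff.rfl }
  rw [← Module.length_eq_finrank k X]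
  apply WithBot.coe_injective
  rw [Module.coe_length, Module.coe_length, Order.krullDim_eq_of_orderIso e]

variable (k) in
/-- The radical of a module as a `k`-subspace. -/
def radicalSubspace (A : Type u) [Ring A] [Algebra k A] (M : Type w) [AddCommGroup M]
    [Module A M] [Module k M] [IsScalarTower k A M] : Submodule k M :=
  (Ring.jacobson A • (⊤ : Submodule A M)).restrictScalars k

variable {M M' : Type w} [AddCommGroup M] [Module A M] [AddCommGroup M'] [Module A M']
namespace IsApproxSeq

variable {n : ℕ} {f : M →ₗ[A] (Fin n → A)} {g : (Fin n → A) →ₗ[A] M'}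

/-- The dual sequence 0 → Hom(M', A) → Aⁿ → Hom(M, A) → 0 is exact; its surjectivity is the
approximation property. -/
theorem finrank_dual_add_finrank_dual [Module.Finite k A] (S : IsApproxSeq f g) :
    Module.finrank k (M →ₗ[A] A) + Module.finrank k (M' →ₗ[A] A) = n * Module.finrank k A := by
  let R : (Fin n → A) →ₗ[k] (M →ₗ[A] A) :=
    { toFun := fun a => ∑ l, (LinearMap.toSpanSingleton A A (a l)) ∘ₗ LinearMap.proj l ∘ₗ f
      map_add' := fun a b => by ext m; simp [mul_add, Finset.sum_add_distrib]
      map_smul' := fun c a => by ext m; simp [Finset.smul_sum] }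
  have hR : ∀ a m, R a m = ∑ l, f m l * a l := fun a m => by simp [R]
  have hRs : Function.Surjective R := fun φ => by
    obtain ⟨a, ha⟩ := S.extend φ
    exact ⟨a, LinearMap.ext fun m => by rw [hR, ha]⟩
  let D : (M' →ₗ[A] A) →ₗ[k] (Fin n → A) :=
    { toFun := fun χ l => χ (g (Pi.single l 1))
      map_add' := fun _ _ => rfl
      map_smul' := fun _ _ => rfl }
  have hD : ∀ χ p, χ (g p) = ∑ l, p l * D χ l := fun χ p =>
    LinearMap.apply_eq_sum_smul (χ ∘ₗ g) p
  have hDi : Function.Injective D := by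
    rw [injective_iff_map_eq_zero]
    intro χ hχ
    ext m
    obtain ⟨p, rfl⟩ := S.surjective m
    rw [hD, hχ]
    simp
  have hex : LinearMap.range D = LinearMap.ker R := by
    ext a
    constructor
    · rintro ⟨χ, rfl⟩
      rw [LinearMap.mem_ker]
      ext m
      rw [hR, ← hD, (S.exact _).2 ⟨m, rfl⟩, map_zero]
      rfl
    · intro ha
      let ψ : (Fin n → A) →ₗ[A] A :=
        ∑ l, (LinearMap.toSpanSingleton A A (a l)) ∘ₗ LinearMap.proj l
      have hψ : ∀ p, ψ p = ∑ l, p l * a l := fun p => by simp [ψ]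
      have hle : LinearMap.ker g ≤ LinearMap.ker ψ := fun p hp => by
        obtain ⟨m, rfl⟩ := (S.exact p).1 hp
        rw [LinearMap.mem_ker, hψ, ← hR, LinearMap.mem_ker.1 ha]
        rfl
      obtain ⟨χ, hχ⟩ := S.exists_form hle
      refine ⟨χ, funext fun l => ?_⟩
      change χ (g _) = _
      rw [hχ, hψ, Finset.sum_eq_single l] <;> simp +contextual
  have h1 := LinearMap.finrank_range_add_finrank_ker R
  rw [LinearMap.range_eq_top.2 hRs, finrank_top, Module.finrank_pi_fintype] at h1
  have h2 := LinearMap.finrank_range_of_inj hDi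
  rw [hex] at h2
  simp at h1
  omega

end IsApproxSeq

variable [Module k M] [IsScalarTower k A M]

theorem mem_radicalSubspace {m : M} :
    m ∈ radicalSubspace k A M ↔ m ∈ Ring.jacobson A • (⊤ : Submodule A M) := Iff.rfl

theorem smul_mem_radicalSubspace {j : A} (hj : j ∈ Ring.jacobson A) (m : M) :
    j • m ∈ radicalSubspace k A M :=
  mem_radicalSubspace.2 (Submodule.smul_mem_smul hj Submodule.mem_top)

/-- The linear forms with values in the square of the radical. -/
def squareForms (k : Type v) [Field k] (A : Type u) [Ring A] [Algebra k A] (M : Type w)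
    [AddCommGroup M] [Module A M] : Submodule k (M →ₗ[A] A) where
  carrier := {φ | ∀ m, φ m ∈ Ring.jacobson A ^ 2}
  add_mem' := fun ha hb m => (Ring.jacobson A ^ 2).add_mem (ha m) (hb m)
  zero_mem' := fun _ => (Ring.jacobson A ^ 2).zero_mem
  smul_mem' := fun c φ hφ m => by
    rw [LinearMap.smul_apply, Algebra.smul_def]
    exact (Ring.jacobson A ^ 2).mul_mem_left _ (hφ m)

/-- A J²-valued form kills J M because J³ = 0; conversely any k-linear map from the top of M to J²
is A-linear. So these forms are Hom_k(M/JM, J²). -/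
theorem finrank_squareForms [Module.Finite k M] [Module.Finite k A]
    (hres : Function.Surjective (algebraMap k (A ⧸ Ring.jacobson A)))
    (hshort : Ring.jacobson A ^ 3 = ⊥) :
    Module.finrank k (squareForms k A M) =
      Module.finrank k (M ⧸ radicalSubspace k A M) * Module.finrank k ↥(Ring.jacobson A ^ 2) := by
  rw [← Module.finrank_linearMap k k]
  symm
  have key : ∀ χ : (M ⧸ radicalSubspace k A M) →ₗ[k] ↥(Ring.jacobson A ^ 2),
      ∃ φ : M →ₗ[A] A, ∀ m, φ m = χ (Submodule.Quotient.mk m) := fun χ =>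
    exists_linearMap_of_annihilated hres
      (((Ring.jacobson A ^ 2).subtype.restrictScalars k) ∘ₗ χ ∘ₗ (radicalSubspace k A M).mkQ)
      (fun j hj m => by
        have : (radicalSubspace k A M).mkQ (j • m) = 0 :=
          (Submodule.Quotient.mk_eq_zero _).2 (smul_mem_radicalSubspace hj m)
        rw [LinearMap.comp_apply, LinearMap.comp_apply, this, map_zero, map_zero])
      (fun j hj m => mul_jacobson_sq hshort hj (χ _).2)
  choose F hF using key
  let L : ((M ⧸ radicalSubspace k A M) →ₗ[k] ↥(Ring.jacobson A ^ 2)) →ₗ[k] squareForms k A M :=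
    { toFun := fun χ => ⟨F χ, fun m => by rw [hF]; exact (χ _).2⟩
      map_add' := fun χ ψ => Subtype.ext (LinearMap.ext fun m => by
        change F _ m = F _ m + F _ m
        simp only [hF]; rfl)
      map_smul' := fun c χ => Subtype.ext (LinearMap.ext fun m => by
        change F _ m = c • F _ m
        simp only [hF]; rfl) }
  refine (LinearEquiv.ofBijective L ⟨?_, ?_⟩).finrank_eq
  · intro χ ψ h
    refine LinearMap.ext fun q => ?_
    obtain ⟨m, rfl⟩ := Submodule.mkQ_surjective _ q
    have : F χ m = F ψ m := congrArg (fun x : squareForms k A M => (x : M →ₗ[A] A) m) h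
    rw [hF, hF] at this
    exact Subtype.ext this
  · rintro ⟨φ, hφ⟩
    let ψ : M →ₗ[k] ↥(Ring.jacobson A ^ 2) :=
      (φ.codRestrict (Ring.jacobson A ^ 2) hφ).restrictScalars k
    have hψ : radicalSubspace k A M ≤ LinearMap.ker ψ := fun m hm => by
      have : φ m = 0 := eq_zero_of_mem_radical φ.toAddMonoidHom (fun j hj m =>
        (map_smul φ j m).trans (mul_jacobson_sq hshort hj (hφ m))) hm
      exact Subtype.ext this
    refine ⟨(radicalSubspace k A M).liftQ ψ hψ, Subtype.ext (LinearMap.ext fun m => ?_)⟩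
    exact hF _ m

namespace IsApproxSeq

variable {n : ℕ} {f : M →ₗ[A] (Fin n → A)} {g : (Fin n → A) →ₗ[A] M'}

/-- The map f restricts to an isomorphism from J M onto (J²)ⁿ. -/
theorem finrank_eq [Module.Finite k A] [Module.Finite k M]
    (S : IsApproxSeq f g)
    (hf : ∀ r ∈ Ring.jacobson A ^ 2, ∀ l : Fin n,
      ∃ m ∈ Ring.jacobson A • (⊤ : Submodule A M), f m = Pi.single l r) :
    Module.finrank k M = Module.finrank k (M ⧸ radicalSubspace k A M) +
      n * Module.finrank k ↥(Ring.jacobson A ^ 2) := by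
  rw [← Submodule.finrank_quotient_add_finrank (radicalSubspace k A M)]
  congr 1
  let E : radicalSubspace k A M →ₗ[k] (Fin n → ↥(Ring.jacobson A ^ 2)) :=
    { toFun := fun m l => ⟨f m l, S.apply_mem_sq (mem_radicalSubspace.1 m.2) l⟩
      map_add' := fun x y => funext fun l => Subtype.ext (congrFun (map_add f (x : M) y) l)
      map_smul' := fun c x => funext fun l => Subtype.ext
        (congrFun ((f.restrictScalars k).map_smul c (x : M)) l) }
  have hbij : Function.Bijective E := by
    constructor
    · intro x y h
      exact Subtype.ext (S.injective (funext fun l => congrArg Subtype.val (congrFun h l)))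
    · intro q
      choose x hx hfx using fun l => hf (q l) (q l).2 l
      refine ⟨⟨∑ l, x l, mem_radicalSubspace.2 (Submodule.sum_mem _ fun l _ => hx l)⟩,
        funext fun l => Subtype.ext ?_⟩
      change f (∑ i, x i) l = q l
      rw [map_sum, Finset.sum_apply, Finset.sum_eq_single l]
      · rw [hfx, Pi.single_eq_same]
      · intro i _ hi
        rw [hfx, Pi.single_eq_of_ne hi.symm]
      · simp
  rw [(LinearEquiv.ofBijective E hbij).finrank_eq, Module.finrank_pi_fintype]
  simp

/-- Modulo J²-valued forms, the n coordinates of f are a k-basis of the dual: they span because only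
residues of coefficients count, and they are independent by `coeff_mem_jacobson`. -/
theorem finrank_dual_eq [Module.Finite k A] [Module.Finite k M]
    (hres : Function.Surjective (algebraMap k (A ⧸ Ring.jacobson A)))
    (hshort : Ring.jacobson A ^ 3 = ⊥) (hsq : ∃ r ∈ Ring.jacobson A ^ 2, r ≠ 0)
    (S : IsApproxSeq f g)
    (hf : ∀ r ∈ Ring.jacobson A ^ 2, ∀ l : Fin n,
      ∃ m ∈ Ring.jacobson A • (⊤ : Submodule A M), f m = Pi.single l r) :
    Module.finrank k (M →ₗ[A] A) = n + Module.finrank k (M ⧸ radicalSubspace k A M) *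
      Module.finrank k ↥(Ring.jacobson A ^ 2) := by
  have hn : Nontrivial A := by
    obtain ⟨r, -, hr⟩ := hsq
    exact ⟨r, 0, hr⟩
  have hfin : Module.Finite k (M →ₗ[A] A) :=
    Module.Finite.of_injective (LinearMap.restrictScalarsₗ k A M A k)
      (LinearMap.restrictScalars_injective k)
  rw [← finrank_squareForms hres hshort,
    ← Submodule.finrank_quotient_add_finrank (squareForms k A M)]
  congr 1
  let D : (Fin n → k) →ₗ[k] (M →ₗ[A] A) ⧸ squareForms k A M :=
    Fintype.linearCombination k fun l => (squareForms k A M).mkQ (LinearMap.proj l ∘ₗ f)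
  have hD : ∀ c : Fin n → k, ∃ φ : M →ₗ[A] A, D c = (squareForms k A M).mkQ φ ∧
      ∀ m, φ m = ∑ l, f m l * algebraMap k A (c l) := fun c => by
    refine ⟨∑ l, c l • (LinearMap.proj l ∘ₗ f), ?_, fun m => ?_⟩
    · simp only [D, Fintype.linearCombination_apply, map_sum, map_smul]
    · simp [LinearMap.sum_apply, Algebra.smul_def, Algebra.commutes]
  have hbij : Function.Bijective D := by
    constructor
    · rw [injective_iff_map_eq_zero]
      intro c hc
      obtain ⟨φ, hφ, ha⟩ := hD c
      rw [hφ, Submodule.mkQ_apply, Submodule.Quotient.mk_eq_zero] at hc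
      funext l
      refine algebraMap_mem_jacobson_iff.1 (coeff_mem_jacobson hres hshort hsq hf (φ := φ)
        (fun m hm => ?_) ha l)
      exact eq_zero_of_mem_radical φ.toAddMonoidHom (fun j hj m =>
        (map_smul φ j m).trans (mul_jacobson_sq hshort hj (hc m))) hm
    · intro q
      obtain ⟨φ, rfl⟩ := Submodule.mkQ_surjective _ q
      obtain ⟨a, ha⟩ := S.extend φ
      choose c hc using fun l => exists_residue hres (a l)
      obtain ⟨ψ, hψ, hc'⟩ := hD c
      refine ⟨c, ?_⟩
      rw [hψ, eq_comm, ← sub_eq_zero, ← map_sub, Submodule.mkQ_apply,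
        Submodule.Quotient.mk_eq_zero]
      intro m
      rw [LinearMap.sub_apply, ha, hc', ← Finset.sum_sub_distrib]
      refine Submodule.sum_mem _ fun l _ => ?_
      rw [← mul_sub]
      exact Ring.mul_mem_jacobson_sq (S.radical m l) (hc l)
  rw [← (LinearEquiv.ofBijective D hbij).finrank_eq]
  simp

variable [Module k M'] [IsScalarTower k A M']

theorem finrank_add_finrank [Module.Finite k A] (S : IsApproxSeq f g) :
    Module.finrank k M + Module.finrank k M' = n * Module.finrank k A := by
  have h1 := LinearMap.finrank_range_add_finrank_ker (g.restrictScalars k)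
  rw [(LinearMap.range_eq_top (f := g.restrictScalars k)).2 S.surjective, finrank_top, Module.finrank_pi_fintype] at h1
  have h2 := LinearMap.finrank_range_of_inj (f := f.restrictScalars k) S.injective
  have h3 : LinearMap.range (f.restrictScalars k) = LinearMap.ker (g.restrictScalars k) := by
    ext p
    exact (S.exact p).symm
  rw [h3] at h2
  simp only [Finset.sum_const, Finset.card_univ, Fintype.card_fin, smul_eq_mul] at h1
  omega

end IsApproxSeq

section Cokernel

variable {N : Type w} [AddCommGroup N] [Module A N] {n : ℕ} {h : N →ₗ[A] (Fin n → A)}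
  {g : (Fin n → A) →ₗ[A] M}

/-- The residues of coefficients identify the top of `Aⁿ` with that of the cokernel. -/
theorem IsApproxSeq.finrank_top_cokernel [Nontrivial A]
    (hres : Function.Surjective (algebraMap k (A ⧸ Ring.jacobson A))) (S : IsApproxSeq h g) :
    Module.finrank k (M ⧸ radicalSubspace k A M) = n := by
  let T : (Fin n → k) →ₗ[k] M ⧸ radicalSubspace k A M :=
    Fintype.linearCombination k fun l => (radicalSubspace k A M).mkQ (g (Pi.single l 1))
  have hT : ∀ c, T c = (radicalSubspace k A M).mkQ (g fun l => algebraMap k A (c l)) := by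
    intro c
    rw [LinearMap.apply_eq_sum_smul g]
    simp only [T, Fintype.linearCombination_apply, map_sum, algebraMap_smul, map_smul]
  have hrad : ∀ y ∈ radicalSubspace k A M, ∃ p : Fin n → A, (∀ l, p l ∈ Ring.jacobson A) ∧
      g p = y := fun y hy =>
    Submodule.smul_induction_on
      (p := fun y => ∃ p : Fin n → A, (∀ l, p l ∈ Ring.jacobson A) ∧ g p = y)
      (mem_radicalSubspace.1 hy)
      (fun j hj m _ => by
        obtain ⟨p, rfl⟩ := S.surjective m
        exact ⟨j • p, fun l => Ring.jacobson_mul_mem_right hj _, map_smul g j p⟩)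
      (by
        rintro _ _ ⟨p, hp, rfl⟩ ⟨q, hq, rfl⟩
        exact ⟨p + q, fun l => add_mem (hp l) (hq l), map_add g p q⟩)
  have hbij : Function.Bijective T := by
    constructor
    · rw [injective_iff_map_eq_zero]
      intro c hc
      rw [hT, Submodule.mkQ_apply, Submodule.Quotient.mk_eq_zero] at hc
      obtain ⟨p, hp, hpg⟩ := hrad _ hc
      rw [← sub_eq_zero, ← map_sub, S.exact] at hpg
      obtain ⟨m, hm⟩ := hpg
      funext l
      have h1 := S.radical m l
      rw [hm, Pi.sub_apply] at h1
      have h2 := sub_mem (hp l) h1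
      rw [sub_sub_cancel] at h2
      exact algebraMap_mem_jacobson_iff.1 h2
    · intro q
      obtain ⟨y, rfl⟩ := Submodule.mkQ_surjective _ q
      obtain ⟨p, rfl⟩ := S.surjective y
      choose c hc using fun l => exists_residue hres (p l)
      refine ⟨c, ?_⟩
      rw [hT, eq_comm, ← sub_eq_zero, ← map_sub, ← map_sub, Submodule.mkQ_apply,
        Submodule.Quotient.mk_eq_zero, LinearMap.apply_eq_sum_smul]
      exact Submodule.sum_mem _ fun l _ => smul_mem_radicalSubspace (hc l) _
  rw [← (LinearEquiv.ofBijective T hbij).finrank_eq]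
  simp

end Cokernel

end Dimension

/-! ### The invariants e and a as dimensions, and a ≥ 2. -/

section Hilbert

variable {k : Type v} [Field k] {A : Type u} [Ring A] [Algebra k A]

theorem finrank_quotient_add_finrank_of_tower {X : Type w} [AddCommGroup X] [Module A X]
    [Module k X] [IsScalarTower k A X] [Module.Finite k X] (p : Submodule A X) :
    Module.finrank k (X ⧸ p) + Module.finrank k p = Module.finrank k X := by
  rw [← LinearMap.finrank_range_add_finrank_ker (p.mkQ.restrictScalars k),
    (LinearMap.range_eq_top (f := p.mkQ.restrictScalars k)).2 (Submodule.mkQ_surjective p),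
    finrank_top]
  have : LinearMap.ker (p.mkQ.restrictScalars k) = p.restrictScalars k := by
    ext x
    exact Submodule.Quotient.mk_eq_zero p
  rw [this]
  rfl

variable [Module.Finite k A]

theorem hilbertA_eq_finrank (hres : Function.Surjective (algebraMap k (A ⧸ Ring.jacobson A)))
    (hshort : Ring.jacobson A ^ 3 = ⊥) :
    hilbertA A = Module.finrank k ↥(Ring.jacobson A ^ 2) :=
  length_eq_finrank_of_annihilated hres fun _ hj x =>
    Subtype.ext (mul_jacobson_sq hshort hj x.2)

theorem hilbertE_eq_finrank (hres : Function.Surjective (algebraMap k (A ⧸ Ring.jacobson A))) :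
    hilbertE A = Module.finrank k (↥(Ring.jacobson A) ⧸
      (Ring.jacobson A ^ 2).submoduleOf (Ring.jacobson A)) :=
  length_eq_finrank_of_annihilated hres fun j hj x => by
    obtain ⟨x, rfl⟩ := Submodule.mkQ_surjective _ x
    rw [← map_smul, Submodule.mkQ_apply, Submodule.Quotient.mk_eq_zero]
    exact Ring.mul_mem_jacobson_sq hj x.2

theorem finrank_eq_hilbert [Nontrivial A]
    (hres : Function.Surjective (algebraMap k (A ⧸ Ring.jacobson A))) :
    Module.finrank k A = 1 + Module.finrank k (↥(Ring.jacobson A) ⧸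
      (Ring.jacobson A ^ 2).submoduleOf (Ring.jacobson A)) +
        Module.finrank k ↥(Ring.jacobson A ^ 2) := by
  have h1 := finrank_quotient_add_finrank_of_tower (k := k) (Ring.jacobson A)
  have h2 := finrank_quotient_add_finrank_of_tower (k := k)
    ((Ring.jacobson A ^ 2).submoduleOf (Ring.jacobson A))
  have h3 : Module.finrank k (A ⧸ Ring.jacobson A) = 1 := by
    refine finrank_eq_one (Ideal.Quotient.mk _ 1) ?_ fun q => ?_
    · intro h
      rw [Ideal.Quotient.eq_zero_iff_mem] at h
      exact (Ring.jacobson_lt_top (R := A)).ne ((Ideal.eq_top_iff_one _).2 h)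
    · obtain ⟨c, rfl⟩ := hres q
      exact ⟨c, by rw [map_one, Algebra.algebraMap_eq_smul_one]⟩
  have h4 : Module.finrank k ↥((Ring.jacobson A ^ 2).submoduleOf (Ring.jacobson A)) =
      Module.finrank k ↥(Ring.jacobson A ^ 2) :=
    ((Submodule.submoduleOfEquivOfLe Ring.jacobson_sq_le).restrictScalars k).finrank_eq
  omega

/-- If `A` is not self-injective and its left socle is `J²`, then `J²` has dimension at least
two. -/
theorem two_le_finrank_sq (hshort : Ring.jacobson A ^ 3 = ⊥) (hinj : ¬ Module.Injective A A)
    (hsoc : ∀ x : A, (∀ j ∈ Ring.jacobson A, j * x = 0) → x ∈ Ring.jacobson A ^ 2) :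
    2 ≤ Module.finrank k ↥(Ring.jacobson A ^ 2) := by
  by_contra! h
  obtain ⟨z, hz⟩ := finrank_le_one_iff.1 (Nat.lt_succ_iff.1 h)
  refine hinj (injective_of_socle_le_span (k := k) hshort (z := z) fun y hy => ?_)
  obtain ⟨c, hc⟩ := hz ⟨y, hsoc y hy⟩
  exact ⟨c, (congrArg Subtype.val hc).symm⟩

end Hilbert

/-- The arithmetic of the dimensions along three consecutive approximation sequences. -/
theorem succ_eq_of_dimension_relations {a e t₀ n₀ n₁ n₂ m₀ m₁ m₂ h₀ h₁ h₂ : ℕ} (ha : 2 ≤ a)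
    (hn₀ : 0 < n₀) (hn₁ : 0 < n₁)
    (hm₀ : m₀ = t₀ + n₀ * a) (hm₁ : m₁ = n₀ + n₁ * a) (hm₂ : m₂ = n₁ + n₂ * a)
    (hh₀ : h₀ = n₀ + t₀ * a) (hh₁ : h₁ = n₁ + n₀ * a) (hh₂ : h₂ = n₂ + n₁ * a)
    (hs₀ : m₀ + m₁ = n₀ * (1 + e + a)) (hs₁ : m₁ + m₂ = n₁ * (1 + e + a))
    (hd₀ : h₀ + h₁ = n₀ * (1 + e + a)) (hd₁ : h₁ + h₂ = n₁ * (1 + e + a)) : a + 1 = e := by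
  subst hm₀ hm₁ hm₂ hh₀ hh₁ hh₂
  zify at *
  have ha' : (a : ℤ) - 1 ≠ 0 := by omega
  -- The dual count minus the original one reads (a − 1)(t₀ − n₁) = 0; here a ≥ 2 is needed.
  have e₀ : (t₀ : ℤ) = n₁ := by
    apply mul_left_cancel₀ ha'
    linear_combination hd₀ - hs₀
  have e₁ : (n₂ : ℤ) = n₀ := by
    apply mul_left_cancel₀ ha'
    linear_combination hs₁ - hd₁
  rw [e₀] at hs₀
  rw [e₁] at hs₁
  have f₀ : ((a : ℤ) + 1) * n₁ = e * n₀ := by linear_combination hs₀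
  have f₁ : ((a : ℤ) + 1) * n₀ = e * n₁ := by linear_combination hs₁
  -- The relations `f₀` and `f₁` are swapped by n₀ ↔ n₁, so their sum has the common factor n₀ + n₁.
  have hne : (n₀ : ℤ) + n₁ ≠ 0 := by omega
  apply mul_right_cancel₀ hne
  linear_combination f₀ + f₁

/-! ### Assembly along the path. -/

section Vertex

variable {k : Type v} [Field k] {A : Type u} [Ring A] [Algebra k A] [Module.Finite k A]

/-- Three consecutive approximation sequences of torsionless modules determine the Hilbert type
of `A` and make the radical solid on both sides. -/
theorem hilbert_eq_and_isSolid_of_isApproxSeq [Nontrivial A]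
    (hres : Function.Surjective (algebraMap k (A ⧸ Ring.jacobson A)))
    (hshort : Ring.jacobson A ^ 3 = ⊥) (hinj : ¬ Module.Injective A A)
    {M₀ M₁ M₂ M₃ : Type w} [AddCommGroup M₀] [Module A M₀] [AddCommGroup M₁] [Module A M₁]
    [AddCommGroup M₂] [Module A M₂] [AddCommGroup M₃] [Module A M₃]
    [Nontrivial M₀] [Nontrivial M₁] [Nontrivial M₂]
    [Module.Finite A M₀] [Module.Finite A M₁] [Module.Finite A M₂]
    (ht₁ : IsTorsionlessModule A M₁) (ht₂ : IsTorsionlessModule A M₂)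
    (ht₃ : IsTorsionlessModule A M₃)
    (hr₁ : ∀ (φ : M₁ →ₗ[A] A) m, φ m ∈ Ring.jacobson A)
    (hr₂ : ∀ (φ : M₂ →ₗ[A] A) m, φ m ∈ Ring.jacobson A)
    (hr₃ : ∀ (φ : M₃ →ₗ[A] A) m, φ m ∈ Ring.jacobson A)
    {n₀ n₁ n₂ : ℕ} {f₀ : M₀ →ₗ[A] (Fin n₀ → A)} {g₀ : (Fin n₀ → A) →ₗ[A] M₁}
    {f₁ : M₁ →ₗ[A] (Fin n₁ → A)} {g₁ : (Fin n₁ → A) →ₗ[A] M₂}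
    {f₂ : M₂ →ₗ[A] (Fin n₂ → A)} {g₂ : (Fin n₂ → A) →ₗ[A] M₃}
    (S₀ : IsApproxSeq f₀ g₀) (S₁ : IsApproxSeq f₁ g₁) (S₂ : IsApproxSeq f₂ g₂) :
    (hilbertA A + 1 = hilbertE A ∧ 2 ≤ hilbertA A) ∧
      IsSolid k A ↥(Ring.jacobson A) ∧ IsSolid k Aᵐᵒᵖ ↥(rightJacobson A) := by
  let _ : Module k M₀ := Module.compHom M₀ (algebraMap k A)
  let _ : Module k M₁ := Module.compHom M₁ (algebraMap k A)
  let _ : Module k M₂ := Module.compHom M₂ (algebraMap k A)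
  let _ : Module k M₃ := Module.compHom M₃ (algebraMap k A)
  have _ : IsScalarTower k A M₀ := ⟨fun c a x => by rw [Algebra.smul_def, mul_smul]; rfl⟩
  have _ : IsScalarTower k A M₁ := ⟨fun c a x => by rw [Algebra.smul_def, mul_smul]; rfl⟩
  have _ : IsScalarTower k A M₂ := ⟨fun c a x => by rw [Algebra.smul_def, mul_smul]; rfl⟩
  have _ : IsScalarTower k A M₃ := ⟨fun c a x => by rw [Algebra.smul_def, mul_smul]; rfl⟩
  have _ : Module.Finite k M₀ := Module.Finite.trans (R := k) A M₀
  have _ : Module.Finite k M₁ := Module.Finite.trans (R := k) A M₁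
  have _ : Module.Finite k M₂ := Module.Finite.trans (R := k) A M₂
  have hsq := S₀.exists_mem_sq_ne_zero hres hshort hinj ht₁ hr₁
  have hf₀ := fun r (hr : r ∈ Ring.jacobson A ^ 2) l =>
    S₀.exists_mem_radical_eq_single hres hshort hinj ht₁ hr₁ hr l
  have hf₁ := fun r (hr : r ∈ Ring.jacobson A ^ 2) l =>
    S₁.exists_mem_radical_eq_single hres hshort hinj ht₂ hr₂ hr l
  have hf₂ := fun r (hr : r ∈ Ring.jacobson A ^ 2) l =>
    S₂.exists_mem_radical_eq_single hres hshort hinj ht₃ hr₃ hr l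
  have hsoc := fun x (hx : ∀ j ∈ Ring.jacobson A, j * x = 0) =>
    S₀.mem_sq_of_annihilated hres hshort hsq hf₀ hx
  have ha := two_le_finrank_sq (k := k) hshort hinj hsoc
  refine ⟨?_, isSolid_jacobson hshort hsq hsoc (S₀.exists_scalar hres hshort fun r hr l => ?_),
    isSolid_rightJacobson hres hshort hsq
      (fun x hx => S₀.mem_sq_of_right_annihilated hres hshort hsq S₁ ht₂ hf₁ hx)
      (S₀.exists_right_scalar hres hshort S₁ ht₂)⟩
  · have hm₁ := S₁.finrank_eq (k := k) hf₁
    have hm₂ := S₂.finrank_eq (k := k) hf₂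
    have hh₁ := S₁.finrank_dual_eq hres hshort hsq hf₁
    have hh₂ := S₂.finrank_dual_eq hres hshort hsq hf₂
    have hs₀ := S₀.finrank_add_finrank (k := k)
    have hs₁ := S₁.finrank_add_finrank (k := k)
    have hd₀ := S₀.finrank_dual_add_finrank_dual (k := k)
    have hd₁ := S₁.finrank_dual_add_finrank_dual (k := k)
    rw [S₀.finrank_top_cokernel hres] at hm₁ hh₁
    rw [S₁.finrank_top_cokernel hres] at hm₂ hh₂
    rw [finrank_eq_hilbert hres] at hs₀ hs₁ hd₀ hd₁
    have := succ_eq_of_dimension_relations ha S₀.pos S₁.pos (S₀.finrank_eq (k := k) hf₀) hm₁ hm₂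
      (S₀.finrank_dual_eq hres hshort hsq hf₀) hh₁ hh₂ hs₀ hs₁ hd₀ hd₁
    rw [hilbertA_eq_finrank hres hshort, hilbertE_eq_finrank hres, ← this]
    exact ⟨by push_cast; rfl, by exact_mod_cast ha⟩
  · obtain ⟨m, -, hm⟩ := hf₀ r hr l
    exact ⟨m, hm⟩

end Vertex

theorem theorem2 (k : Type v) [Field k] (A : Type u) [Ring A] [Algebra k A]
    [Module.Finite k A] [IsLocalRing A]
    (hres : Function.Surjective (algebraMap k (A ⧸ Ring.jacobson A)))
    (hshort : Ring.jacobson A ^ 3 = ⊥)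
    (hnsi : ¬ Module.Injective A A)
    (hpath : HasMhoPath.{u, w} A 4) :
    (hilbertA A + 1 = hilbertE A ∧ 2 ≤ hilbertA A) ∧
      IsSolid k A ↥(Ring.jacobson A) ∧ IsSolid k Aᵐᵒᵖ ↥(rightJacobson A) := by
  obtain ⟨M, hv, hM⟩ := hpath
  have hrad : ∀ i, ∀ (φ : M i →ₗ[A] A) m, φ m ∈ Ring.jacobson A := fun i =>
    (hv i).indecomposable.apply_mem_jacobson hres hshort (hv i).notProjective
  have hnt : ∀ i, Nontrivial (M i) := fun i => (hv i).indecomposable.1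
  have hfin : ∀ i, Module.Finite A (M i) := fun i => by
    have := (isFiniteLength_iff_isNoetherian_isArtinian.1 (hv i).finiteLength).1
    infer_instance
  obtain ⟨n₀, f₀, g₀, S₀⟩ := exists_isApproxSeq hres (hrad 0) (hM 0).1 (hM 0).2
  obtain ⟨n₁, f₁, g₁, S₁⟩ := exists_isApproxSeq hres (hrad 1) (hM 1).1 (hM 1).2
  obtain ⟨n₂, f₂, g₂, S₂⟩ := exists_isApproxSeq hres (hrad 2) (hM 2).1 (hM 2).2
  -- Three sequences suffice; the fourth arrow enters only through the torsionlessness of `M 3`.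
  exact hilbert_eq_and_isSolid_of_isApproxSeq hres hshort hnsi (hM 1).1 (hM 2).1 (hM 3).1
    (hrad 1) (hrad 2) (hrad 3) S₀ S₁ S₂
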